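/- A 0-1 matrix $A$ contains a 0-1 matrix $P$ if some submatrix of $A$ (obtained by selecting rows and columns, in their original order) is equal to $P$ or can be turned into $P$ by changing some ones to zeroes; otherwise $A$ avoids $P$. A 0-1 matrix $A$ is saturating for $P$ if $A$ avoids $P$ but changing any single zero of $A$ to a one gives a matrix that contains $P$. Let $\mathrm{sat}(n,P)$ be the minimum number of ones in an $n\times n$ 0-1 matrix that is saturating for $P$. Theorem. Almost all $k\times k$ permutation matrices $P$ satisfy $\mathrm{sat}(n,P)=O(1)$. That is, the proportion, among the $k!$ permutation matrices of size $k\times k$, of those $P$ for which there is a constant $C_P$ with $\mathrm{sat}(n,P)\le C_P$ for all $n$, tends to $1$ as $k\to\infty$. -/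

import Mathlib

open Filter Topology

/-- A 0-1 matrix with `m` rows and `n` columns (`true` is a one, `false` is a zero). -/
abbrev ZeroOneMatrix (m n : ℕ) : Type := Matrix (Fin m) (Fin n) Bool

namespace ZeroOneMatrix

/-- `A` contains `P`: some submatrix of `A` (rows `f`, columns `g`, both in increasing order)
is equal to `P` or can be turned into `P` by changing some ones to zeroes. -/
def Contains {m n k l : ℕ} (A : ZeroOneMatrix m n) (P : ZeroOneMatrix k l) : Prop :=
  ∃ (f : Fin k ↪o Fin m) (g : Fin l ↪o Fin n),
    ∀ i j, P i j = true → A (f i) (g j) = true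

/-- `A` avoids `P` if it does not contain `P`. -/
def Avoids {m n k l : ℕ} (A : ZeroOneMatrix m n) (P : ZeroOneMatrix k l) : Prop :=
  ¬ Contains A P

/-- The matrix `A` with the entry in position `(i, j)` set to one. -/
def setOne {m n : ℕ} (A : ZeroOneMatrix m n) (i : Fin m) (j : Fin n) : ZeroOneMatrix m n :=
  Matrix.of fun i' j' => if i' = i ∧ j' = j then true else A i' j'

/-- `A` is saturating for `P`: it avoids `P`, but changing any zero of `A` to a one
creates a copy of `P`. -/
def IsSaturating {m n k l : ℕ} (A : ZeroOneMatrix m n) (P : ZeroOneMatrix k l) : Prop :=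
  Avoids A P ∧ ∀ i j, A i j = false → Contains (setOne A i j) P

/-- The number of ones of `A`. -/
def ones {m n : ℕ} (A : ZeroOneMatrix m n) : ℕ :=
  (Finset.univ.filter fun p : Fin m × Fin n => A p.1 p.2 = true).card

/-- `sat n P`: the minimum number of ones in an `n × n` 0-1 matrix that is saturating for `P`.
It takes values in `ℕ∞`, so that it would be `⊤` (not `0`) if there were no such matrix. -/
noncomputable def sat {k l : ℕ} (n : ℕ) (P : ZeroOneMatrix k l) : ℕ∞ :=
  ⨅ (A : ZeroOneMatrix n n) (_ : IsSaturating A P), (ones A : ℕ∞)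

/-- `sat n P = O(1)`, with a bound that may depend on `P` but not on `n`. -/
def HasBoundedSat {k l : ℕ} (P : ZeroOneMatrix k l) : Prop :=
  ∃ C : ℕ, ∀ n : ℕ, sat n P ≤ (C : ℕ∞)

/-- `P` is a permutation matrix: exactly one one in each row and in each column. -/
def IsPermutationMatrix {k : ℕ} (P : ZeroOneMatrix k k) : Prop :=
  (∀ i, ∃! j, P i j = true) ∧ (∀ j, ∃! i, P i j = true)

end ZeroOneMatrix

/-! It suffices to find one matrix `A` avoiding `P`, with an empty row and an empty column, in which
a one added anywhere in that row or column creates a copy of `P` (`hasBoundedSat_of_witness`).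
Repeating the empty row and column up to size `n` keeps `P` avoided, and a saturating extension can
have no one in any of the repeated lines, so its number of ones is bounded independently of `n`.

For the empty row, put `P` without its last column to the left of `P` without its first column
(`doubled`), with the rows of the two missing ones identified as a single empty row. A new one there
completes the left block if it lies to the right of it, and the right block otherwise. The
transposed construction for the inverse permutation supplies the empty column; the two pieces are
placed antidiagonally.

Avoidance holds for generic `P`. A copy split between the two pieces would make `P`
skew-decomposable. A copy inside one piece has its first `l` columns in the left block. If `2 ≤ l ≤
k - 2`, the interleaving of the rows of the two blocks makes these columns structured. The case of a
single column in one of the blocks cannot be excluded by genericity, since one column is always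
structured; it is the reason why the blocks also share the two neighbours of the empty row, which
force the remaining one of the copy into that row.

Structured permutations are rare: the first `l` columns have `O(l(k-l))` possible row sets, which
leaves `O((k-1)!)` non-generic permutations in total, a proportion `O(1/k)`. -/

namespace ZeroOneMatrix

/-! ### Saturating extensions and blowing up an empty row and column -/

section Saturation

variable {m n k l : ℕ}

theorem setOne_of_eq_true {A : ZeroOneMatrix m n} {i' : Fin m} {j' : Fin n}
    (h : A i' j' = true) (i : Fin m) (j : Fin n) : setOne A i j i' j' = true := by
  simp [setOne, h]

theorem Contains.mono {A B : ZeroOneMatrix m n} {P : ZeroOneMatrix k l}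
    (hAB : ∀ i j, A i j = true → B i j = true) (h : Contains A P) : Contains B P := by
  obtain ⟨f, g, hfg⟩ := h
  exact ⟨f, g, fun i j hij => hAB _ _ (hfg i j hij)⟩

theorem ones_lt_ones_setOne {A : ZeroOneMatrix m n} {i : Fin m} {j : Fin n}
    (h : A i j = false) : ones A < ones (setOne A i j) := by
  refine Finset.card_lt_card (Finset.ssubset_iff_of_subset ?_ |>.2 ⟨(i, j), ?_, ?_⟩)
  · intro p hp
    simp only [Finset.mem_filter, Finset.mem_univ, true_and] at hp ⊢
    exact setOne_of_eq_true hp i j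
  · simp [setOne]
  · simp [h]

/-- Every matrix avoiding `P` lies below a matrix that is saturating for `P`. -/
theorem Avoids.exists_isSaturating {A : ZeroOneMatrix m n} {P : ZeroOneMatrix k l}
    (hA : Avoids A P) :
    ∃ B : ZeroOneMatrix m n, (∀ i j, A i j = true → B i j = true) ∧ IsSaturating B P := by
  obtain ⟨B, ⟨hAB, hB⟩, hmax⟩ := Set.exists_max_image
    {B : ZeroOneMatrix m n | (∀ i j, A i j = true → B i j = true) ∧ Avoids B P} ones
    (Set.toFinite _) ⟨A, fun _ _ h => h, hA⟩
  refine ⟨B, hAB, hB, fun i j hij => ?_⟩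
  by_contra hcon
  have := hmax (setOne B i j)
    ⟨fun i' j' h => setOne_of_eq_true (hAB i' j' h) i j, hcon⟩
  exact absurd (ones_lt_ones_setOne hij) (not_lt.2 this)

theorem ones_le (A : ZeroOneMatrix m n) : ones A ≤ m * n := by
  refine (Finset.card_filter_le _ _).trans ?_
  simp

theorem IsSaturating.sat_le {A : ZeroOneMatrix n n} {P : ZeroOneMatrix k l}
    (h : IsSaturating A P) : sat n P ≤ (ones A : ℕ∞) :=
  iInf₂_le A h

/-- A monotone surjection `Fin n → Fin N` all of whose fibres but that of `r` are singletons. -/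
theorem exists_collapse {N n : ℕ} (h : N ≤ n) (r : Fin N) :
    ∃ ρ : Fin n → Fin N, Monotone ρ ∧ Function.Surjective ρ ∧
      ∀ i j, ρ i = ρ j → ρ i ≠ r → i = j := by
  obtain ⟨d, rfl⟩ := Nat.exists_eq_add_of_le h
  obtain ⟨r, hr⟩ := r
  refine ⟨fun i => ⟨if i.1 < r then i.1 else if i.1 ≤ r + d then r else i.1 - d, ?_⟩, ?_, ?_, ?_⟩
  · have := i.2
    split_ifs <;> omega
  · intro i j hij
    have hij' : i.1 ≤ j.1 := hij
    simp only [Fin.le_def]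
    split_ifs <;> omega
  · intro x
    have := x.2
    by_cases hx : x.1 < r
    · exact ⟨⟨x.1, by omega⟩, by ext; simp only [if_pos hx]⟩
    · refine ⟨⟨x.1 + d, by omega⟩, ?_⟩
      ext
      simp only
      split_ifs <;> omega
  · intro i j hij hne
    simp only [Fin.mk.injEq, ne_eq] at hij hne
    ext
    split_ifs at hij hne <;> omega

/-- A surjective monotone map has a section through any given point, and it is an order
embedding. -/
theorem exists_section {N n : ℕ} {ρ : Fin n → Fin N} (hρ : Monotone ρ)
    (hs : Function.Surjective ρ) (i : Fin n) :
    ∃ s : Fin N ↪o Fin n, (∀ x, ρ (s x) = x) ∧ s (ρ i) = i := by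
  obtain ⟨t, ht⟩ := hs.hasRightInverse
  have key : ∀ x, ρ (if x = ρ i then i else t x) = x := by
    intro x
    split_ifs with h
    · exact h.symm
    · exact ht x
  refine ⟨OrderEmbedding.ofStrictMono (fun x => if x = ρ i then i else t x) ?_, key, if_pos rfl⟩
  intro x y hxy
  by_contra hle
  have := hρ (not_lt.1 hle)
  rw [key, key] at this
  exact absurd hxy (not_lt.2 this)

/-- A matrix avoiding `P` with a zero row and a zero column in which every new one creates a copy
of `P` can be blown up there, which bounds the saturation function of `P`. -/
theorem hasBoundedSat_of_witness {N : ℕ} (hk : 0 < k) {P : ZeroOneMatrix k k}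
    (hrow : ∀ i, ∃ j, P i j = true) (hcol : ∀ j, ∃ i, P i j = true)
    {A : ZeroOneMatrix N N} (hA : Avoids A P) (r c : Fin N)
    (hr : ∀ j, A r j = false) (hc : ∀ i, A i c = false)
    (hr' : ∀ j, Contains (setOne A r j) P) (hc' : ∀ i, Contains (setOne A i c) P) :
    HasBoundedSat P := by
  refine ⟨N * N, fun n => ?_⟩
  -- For `n ≤ N` any saturating matrix will do; one exists above the zero matrix.
  rcases le_total n N with hn | hn
  · have hzero : Avoids (Matrix.of fun _ _ => false : ZeroOneMatrix n n) P := by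
      rintro ⟨f, g, hfg⟩
      obtain ⟨j, hj⟩ := hrow ⟨0, hk⟩
      simpa using hfg _ _ hj
    obtain ⟨B, -, hB⟩ := hzero.exists_isSaturating
    refine hB.sat_le.trans ?_
    exact_mod_cast (ones_le B).trans (Nat.mul_le_mul hn hn)
  obtain ⟨ρ, hρ, hρs, hρi⟩ := exists_collapse hn r
  obtain ⟨κ, hκ, hκs, hκi⟩ := exists_collapse hn c
  have hB : Avoids (Matrix.of fun i j => A (ρ i) (κ j) : ZeroOneMatrix n n) P := by
    rintro ⟨f, g, hfg⟩
    simp only [Matrix.of_apply] at hfg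
    refine hA ⟨OrderEmbedding.ofStrictMono (fun i => ρ (f i)) ?_,
      OrderEmbedding.ofStrictMono (fun j => κ (g j)) ?_, hfg⟩
    · intro i i' hii
      refine lt_of_le_of_ne (hρ (f.monotone hii.le)) fun heq => ?_
      obtain ⟨j, hj⟩ := hrow i
      refine hii.ne (f.injective (hρi _ _ heq fun h0 => ?_))
      have := hfg i j hj
      rw [h0, hr] at this
      exact absurd this (by simp)
    · intro j j' hjj
      refine lt_of_le_of_ne (hκ (g.monotone hjj.le)) fun heq => ?_
      obtain ⟨i, hi⟩ := hcol j
      refine hjj.ne (g.injective (hκi _ _ heq fun h0 => ?_))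
      have := hfg i j hi
      rw [h0, hc] at this
      exact absurd this (by simp)
  -- Sections of the two collapsing maps through `i` and `j` carry a copy that uses the new one of
  -- `A` to a copy that uses the new one of the blow-up.
  have lift : ∀ i j, Contains (setOne A (ρ i) (κ j)) P →
      Contains (setOne (Matrix.of fun i j => A (ρ i) (κ j) : ZeroOneMatrix n n) i j) P := by
    rintro i j ⟨f, g, hfg⟩
    obtain ⟨s, hs, hsi⟩ := exists_section hρ hρs i
    obtain ⟨t, ht, htj⟩ := exists_section hκ hκs j
    refine ⟨f.trans s, g.trans t, fun x y hxy => ?_⟩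
    have := hfg x y hxy
    simp only [setOne, Matrix.of_apply, RelEmbedding.coe_trans, Function.comp_apply] at this ⊢
    split_ifs at this with h
    · rw [h.1, h.2, hsi, htj]
      simp
    · rw [hs, ht, this]
      simp
  obtain ⟨B, hAB, hB'⟩ := hB.exists_isSaturating
  refine hB'.sat_le.trans ?_
  -- A one of `B` over the empty row or column would give, by lifting, a copy of `P` already present
  -- in `B`. Outside these fibres the collapsing maps are injective, so `B` has at most `N * N`
  -- ones.
  have hnot : ∀ i j, B i j = true → ρ i ≠ r ∧ κ j ≠ c := by
    intro i j hij
    have hno : ¬ Contains (setOne A (ρ i) (κ j)) P := by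
      intro hcon
      refine hB'.1 ((lift i j hcon).mono fun i' j' h => ?_)
      simp only [setOne, Matrix.of_apply] at h
      split_ifs at h with h'
      · rw [h'.1, h'.2, hij]
      · exact hAB i' j' h
    exact ⟨fun h => hno (h ▸ hr' _), fun h => hno (h ▸ hc' _)⟩
  have hcard : ones B ≤ (Finset.univ : Finset (Fin N × Fin N)).card := by
    refine Finset.card_le_card_of_injOn (fun p => (ρ p.1, κ p.2)) (fun _ _ => Finset.mem_univ _) ?_
    rintro ⟨i, j⟩ hp ⟨i', j'⟩ - heq
    simp only [Finset.coe_filter, Finset.mem_univ, true_and, Set.mem_ofPred_eq] at hp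
    simp only [Prod.mk.injEq] at heq
    rw [hρi _ _ heq.1 (hnot _ _ hp).1, hκi _ _ heq.2 (hnot _ _ hp).2]
  simp only [Finset.card_univ, Fintype.card_prod, Fintype.card_fin] at hcard
  exact_mod_cast hcard

end Saturation
-- The doubled matrix and its avoidance of a generic permutation
section Construction

variable {k : ℕ}

theorem strictMono_add_le {f : Fin k → ℕ} (hf : StrictMono f) {i j : Fin k} (hij : i ≤ j) :
    f i + (j.1 - i.1) ≤ f j := by
  obtain ⟨j, hj⟩ := j
  obtain ⟨d, rfl⟩ := Nat.exists_eq_add_of_le (show i.1 ≤ j from hij)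
  clear hij
  induction d with
  | zero => simp
  | succ d ih =>
    have h1 := ih (by omega)
    have h2 : f ⟨i.1 + d, by omega⟩ < f ⟨i.1 + (d + 1), hj⟩ := hf (by simp [Fin.lt_def])
    simp only at h1 ⊢
    omega

theorem exists_threshold {f : Fin k → ℕ} (hf : StrictMono f) (x : ℕ) :
    ∃ t ≤ k, ∀ i, f i < x ↔ i.1 < t := by
  classical
  by_cases h : ∃ t, ∃ ht : t < k, x ≤ f ⟨t, ht⟩
  · obtain ⟨ht, hx⟩ := Nat.find_spec h
    refine ⟨Nat.find h, ht.le, fun i => ⟨fun hi => ?_, fun hi => ?_⟩⟩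
    · by_contra hcon
      have := hf.monotone (show (⟨Nat.find h, ht⟩ : Fin k) ≤ i from not_lt.1 hcon)
      omega
    · by_contra hcon
      exact Nat.find_min h hi ⟨i.2, not_lt.1 hcon⟩
  · push Not at h
    exact ⟨k, le_rfl, fun i => ⟨fun _ => i.2, fun _ => h i.1 i.2⟩⟩

/-- The first `l` columns of the permutation matrix of `π` occupy, outside a window of at most three
rows, exactly an initial segment of the rows above the window and one of the rows below it. -/
def IsStructured (π : Equiv.Perm (Fin k)) (l : ℕ) : Prop :=
  ∃ t₁ t₂ t₃ t₄ : ℕ, t₁ ≤ t₂ ∧ t₂ ≤ t₃ ∧ t₃ ≤ t₄ ∧ t₄ ≤ k ∧ t₃ ≤ t₂ + 3 ∧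
    ∀ j, ((π j).1 < t₂ ∨ t₃ ≤ (π j).1) →
      (j.1 < l ↔ (π j).1 < t₁ ∨ (t₃ ≤ (π j).1 ∧ (π j).1 < t₄))

/-- No corner is occupied, and no nontrivial initial block of columns is structured. -/
structure IsGeneric (π : Equiv.Perm (Fin k)) : Prop where
  interior : ∀ j, (j.1 = 0 ∨ j.1 + 1 = k) → 0 < (π j).1 ∧ (π j).1 + 1 < k
  not_isStructured : ∀ l, 2 ≤ l → l + 2 ≤ k → ¬ IsStructured π l

/-- Position of row `x` of the left block, whose row `b` is the empty row `a + b - 1`. -/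
def rowL (a b x : ℕ) : ℕ := if x + 1 < b then x else x + a - 1

/-- Position of row `x` of the right block, whose row `a` is the empty row `a + b - 1`. -/
def rowR (k a b x : ℕ) : ℕ := if x ≤ a + 1 then x + b - 1 else x + k - 3

/-- The permutation matrix of `π` without its last column, followed by the same matrix without its
first column. The two blocks share the rows next to the empty row `a + b - 1`. Here `a` and `b` are
the rows of the ones in the first and last column, and columns are shifted by `o`. -/
def doubled (π : Equiv.Perm (Fin k)) (a b o x y : ℕ) : Prop :=
  (∃ j : Fin k, j.1 + 1 < k ∧ y = o + j ∧ x = rowL a b (π j)) ∨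
    (∃ j : Fin k, 1 ≤ j.1 ∧ y = o + (k - 2) + j ∧ x = rowR k a b (π j))

theorem rowL_strictMono {a b : ℕ} (_ : 0 < a) : StrictMono (rowL a b) := by
  intro x y h
  simp only [rowL]
  split_ifs <;> omega

theorem rowR_strictMono {k a b : ℕ} (_ : a + 1 < k) (hb : b + 1 < k) (hb' : 0 < b) :
    StrictMono (rowR k a b) := by
  intro x y h
  simp only [rowR]
  split_ifs <;> omega

variable {π : Equiv.Perm (Fin k)} {a b o : ℕ}

/-- Let `l` be the number of columns of the copy in the left block. If `l ≤ 1` or `l ≥ k - 1`, one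
block is used in full and the shared rows force a one into the empty row. For other `l` the order of
the row ranges of the blocks shows that the first `l` columns are structured. -/
theorem not_doubled_of_isGeneric (hπ : IsGeneric π)
    (ha : ∀ j : Fin k, j.1 = 0 → (π j).1 = a) (hb : ∀ j : Fin k, j.1 + 1 = k → (π j).1 = b)
    (hk : 0 < k) {f g : Fin k → ℕ} (hf : StrictMono f) (hg : StrictMono g) :
    ¬ ∀ j, doubled π a b o (f (π j)) (g j) := by
  intro H
  have hzero : (⟨0, hk⟩ : Fin k).1 = 0 := rfl
  have hlast : (⟨k - 1, by omega⟩ : Fin k).1 + 1 = k := by simp only; omega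
  have ha1 := ha _ hzero
  have hb1 := hb _ hlast
  have ha2 := hπ.interior _ (Or.inl hzero)
  have hb2 := hπ.interior _ (Or.inr hlast)
  rw [ha1] at ha2
  rw [hb1] at hb2
  obtain ⟨l, hl, hgl⟩ := exists_threshold hg (o + (k - 1))
  have hL : ∀ j : Fin k, j.1 < l →
      ∃ i : Fin k, i.1 + 1 < k ∧ g j = o + i ∧ f (π j) = rowL a b (π i) := by
    intro j hj
    have := (hgl j).2 hj
    rcases H j with h | ⟨i, hi, h, -⟩
    · exact h
    · omega
  have hR : ∀ j : Fin k, l ≤ j.1 →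
      ∃ i : Fin k, 1 ≤ i.1 ∧ g j = o + (k - 2) + i ∧ f (π j) = rowR k a b (π i) := by
    intro j hj
    have := (hgl j).not.2 (not_lt.2 hj)
    rcases H j with ⟨i, hi, h, -⟩ | h
    · omega
    · exact h
  have hLrow : rowL a b b = a + b - 1 := by simp only [rowL]; split_ifs <;> omega
  have hRrow : rowR k a b a = a + b - 1 := by simp only [rowR]; split_ifs <;> omega
  -- Once its two neighbours sit in the shared rows `a + b - 2` and `a + b`, row `r` is squeezed
  -- into the empty row.
  have hadj : ∀ r : ℕ, 0 < r → r + 1 < k → (∀ i : Fin k, i.1 = r - 1 → f i = a + b - 2) →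
      (∀ i : Fin k, i.1 = r + 1 → f i = a + b) → ∀ i : Fin k, i.1 = r → f i = a + b - 1 := by
    intro r hr0 hr h1 h2 i hi
    have e1 := h1 ⟨r - 1, by omega⟩ rfl
    have e2 := h2 ⟨r + 1, by omega⟩ rfl
    have l1 : f ⟨r - 1, by omega⟩ < f i := hf (by simp only [Fin.lt_def]; omega)
    have l2 : f i < f ⟨r + 1, by omega⟩ := hf (by simp only [Fin.lt_def]; omega)
    omega
  by_cases hl1 : l ≤ 1
  -- The right block has only `k - 1` columns, so the columns `1, ..., k - 1` of the copy must
  -- occupy them in order. This fixes every row but `a`.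
  · have hfull : ∀ j : Fin k, 1 ≤ j.1 → f (π j) = rowR k a b (π j) := by
      intro j hj
      obtain ⟨i, hi, hgi, hfi⟩ := hR j (by omega)
      obtain ⟨i', -, hgi', -⟩ := hR ⟨k - 1, by omega⟩ (by simp only; omega)
      have h1 := strictMono_add_le hg (show j ≤ ⟨k - 1, by omega⟩ by
        simp only [Fin.le_def]; omega)
      obtain ⟨i'', hi'', hgi'', -⟩ := hR ⟨1, by omega⟩ (by simp only; omega)
      have h2 := strictMono_add_le hg (show ⟨1, by omega⟩ ≤ j by simp only [Fin.le_def]; omega)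
      simp only at h1 h2
      have : i = j := by ext; omega
      rw [hfi, this]
    have hfull' : ∀ i : Fin k, i.1 ≠ a → f i = rowR k a b i := by
      intro i hi
      have := hfull (π.symm i) (by
        by_contra hcon
        have := ha (π.symm i) (by omega)
        rw [Equiv.apply_symm_apply] at this
        exact hi this)
      rwa [Equiv.apply_symm_apply] at this
    have hr := hadj a ha2.1 ha2.2
      (fun i hi => by
        rw [hfull' i (by omega), hi]; simp only [rowR]; split_ifs <;> omega)
      (fun i hi => by
        rw [hfull' i (by omega), hi]; simp only [rowR]; split_ifs <;> omega)
      _ ha1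
    by_cases hl0 : l = 0
    · obtain ⟨i, hi, hgi, -⟩ := hR ⟨0, hk⟩ (by omega)
      obtain ⟨i', -, hgi', -⟩ := hR ⟨k - 1, by omega⟩ (by simp only; omega)
      have := strictMono_add_le hg (show (⟨0, hk⟩ : Fin k) ≤ ⟨k - 1, by omega⟩ by
        simp [Fin.le_def])
      simp only at this
      omega
    · obtain ⟨i, hi, -, hfi⟩ := hL ⟨0, hk⟩ (by simp only; omega)
      rw [hr, ← hLrow] at hfi
      have h1 := (rowL_strictMono ha2.1).injective hfi
      have : i = ⟨k - 1, by omega⟩ := π.injective (Fin.ext (by rw [← h1, hb1]))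
      rw [this] at hi
      simp only at hi
      omega
  by_cases hl2 : k ≤ l + 1
  · have hfull : ∀ j : Fin k, j.1 + 1 < k → f (π j) = rowL a b (π j) := by
      intro j hj
      obtain ⟨i, hi, hgi, hfi⟩ := hL j (by omega)
      obtain ⟨i', -, hgi', -⟩ := hL ⟨0, hk⟩ (by simp only; omega)
      have h1 := strictMono_add_le hg (show ⟨0, hk⟩ ≤ j by simp only [Fin.le_def]; omega)
      obtain ⟨i'', hi'', hgi'', -⟩ := hL ⟨k - 2, by omega⟩ (by simp only; omega)
      have h2 := strictMono_add_le hg (show j ≤ ⟨k - 2, by omega⟩ by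
        simp only [Fin.le_def]; omega)
      simp only at h1 h2
      have : i = j := by ext; omega
      rw [hfi, this]
    have hfull' : ∀ i : Fin k, i.1 ≠ b → f i = rowL a b i := by
      intro i hi
      have := hfull (π.symm i) (by
        by_contra hcon
        have := hb (π.symm i) (by omega)
        rw [Equiv.apply_symm_apply] at this
        exact hi this)
      rwa [Equiv.apply_symm_apply] at this
    have hr := hadj b hb2.1 hb2.2
      (fun i hi => by
        rw [hfull' i (by omega), hi]; simp only [rowL]; split_ifs <;> omega)
      (fun i hi => by
        rw [hfull' i (by omega), hi]; simp only [rowL]; split_ifs <;> omega)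
      _ hb1
    by_cases hlk : l = k
    · obtain ⟨i, hi, hgi, -⟩ := hL ⟨0, hk⟩ (by simp only; omega)
      obtain ⟨i', hi', hgi', -⟩ := hL ⟨k - 1, by omega⟩ (by simp only; omega)
      have := strictMono_add_le hg (show (⟨0, hk⟩ : Fin k) ≤ ⟨k - 1, by omega⟩ by
        simp [Fin.le_def])
      simp only at this
      omega
    · obtain ⟨i, hi, -, hfi⟩ := hR ⟨k - 1, by omega⟩ (by simp only; omega)
      rw [hr, ← hRrow] at hfi
      have h1 := (rowR_strictMono ha2.2 hb2.2 hb2.1).injective hfi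
      have : i = ⟨0, hk⟩ := π.injective (Fin.ext (by rw [← h1, ha1]))
      rw [this] at hi
      simp only at hi
      omega
  refine hπ.not_isStructured l (by omega) (by omega) ?_
  -- From top to bottom the rows are: left block only up to `b - 2`; right block only up to `a + b -
  -- 3`; the three shared rows `a + b - 2`, `a + b - 1`, `a + b`; left block only up to `a + k - 2`;
  -- right block only. The thresholds are these boundaries pulled back along `f`, and the window
  -- consists of the rows mapped to shared rows.
  obtain ⟨t₁, ht₁, h₁⟩ := exists_threshold hf (b - 1)
  obtain ⟨t₂, ht₂, h₂⟩ := exists_threshold hf (a + b - 2)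
  obtain ⟨t₃, ht₃, h₃⟩ := exists_threshold hf (a + b + 1)
  obtain ⟨t₄, ht₄, h₄⟩ := exists_threshold hf (a + k - 1)
  have mono : ∀ {s t x y : ℕ}, s ≤ k → (∀ i : Fin k, f i < x ↔ i.1 < s) →
      (∀ i : Fin k, f i < y ↔ i.1 < t) → x ≤ y → s ≤ t := by
    intro s t x y hs hx hy hxy
    by_contra hcon
    have h1 := (hx ⟨t, by omega⟩).2 (by simp only; omega)
    have h2 := (hy ⟨t, by omega⟩).1 (by omega)
    simp at h2
  refine ⟨t₁, t₂, t₃, t₄, mono ht₁ h₁ h₂ (by omega), mono ht₂ h₂ h₃ (by omega),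
    mono ht₃ h₃ h₄ (by omega), ht₄, ?_, ?_⟩
  · by_contra hcon
    have h1 := (h₂ ⟨t₂, by omega⟩).not.2 (by simp)
    have h2 := (h₃ ⟨t₂ + 3, by omega⟩).2 (by simp only; omega)
    have h3 := strictMono_add_le hf
      (show (⟨t₂, by omega⟩ : Fin k) ≤ ⟨t₂ + 3, by omega⟩ by simp [Fin.le_def])
    simp only at h3
    omega
  · intro j hj
    have e1 := h₁ (π j)
    have e2 := h₂ (π j)
    have e3 := h₃ (π j)
    have e4 := h₄ (π j)
    by_cases hjl : j.1 < l
    · obtain ⟨i, -, -, hfi⟩ := hL j hjl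
      simp only [rowL] at hfi
      split_ifs at hfi <;> omega
    · obtain ⟨i, -, -, hfi⟩ := hR j (not_lt.1 hjl)
      simp only [rowR] at hfi
      split_ifs at hfi <;> omega

end Construction
-- Permutation matrices and the antidiagonal witness
section PermMatrix

variable {k : ℕ}

/-- The permutation matrix with ones in the positions `(π j, j)`. -/
def permMatrix (π : Equiv.Perm (Fin k)) : ZeroOneMatrix k k :=
  Matrix.of fun i j => decide (π j = i)

theorem permMatrix_eq_true {π : Equiv.Perm (Fin k)} {i j : Fin k} :
    permMatrix π i j = true ↔ π j = i := by
  simp [permMatrix]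

theorem isPermutationMatrix_permMatrix (π : Equiv.Perm (Fin k)) :
    (permMatrix π).IsPermutationMatrix := by
  refine ⟨fun i => ⟨π.symm i, ?_, ?_⟩, fun j => ⟨π j, ?_, ?_⟩⟩
  · simp [permMatrix_eq_true]
  · intro j hj
    simp only [permMatrix_eq_true] at hj
    simp [← hj]
  · simp [permMatrix_eq_true]
  · intro i hi
    simp only [permMatrix_eq_true] at hi
    exact hi.symm

theorem permMatrix_bijective :
    Function.Bijective fun π : Equiv.Perm (Fin k) =>
      (⟨permMatrix π, isPermutationMatrix_permMatrix π⟩ :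
        {P : ZeroOneMatrix k k // P.IsPermutationMatrix}) := by
  constructor
  · intro π τ h
    ext j : 1
    have h' : permMatrix π = permMatrix τ := congrArg Subtype.val h
    have : permMatrix τ (π j) j = true := by rw [← h', permMatrix_eq_true]
    exact (permMatrix_eq_true.1 this).symm
  · rintro ⟨P, hrow, hcol⟩
    choose p hp hp' using id hcol
    choose q hq hq' using id hrow
    refine ⟨⟨p, q, fun j => (hq' _ _ (hp j)).symm, fun i => (hp' _ _ (hq i)).symm⟩, ?_⟩
    ext i j
    rw [Bool.eq_iff_iff]
    simp only [permMatrix_eq_true, Equiv.coe_fn_mk]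
    exact ⟨fun h => h ▸ hp j, fun h => (hp' j i h).symm⟩

theorem card_isPermutationMatrix :
    Nat.card {P : ZeroOneMatrix k k // P.IsPermutationMatrix} = k.factorial := by
  rw [← Nat.card_eq_of_bijective _ permMatrix_bijective, Nat.card_perm, Nat.card_fin]

theorem card_isPermutationMatrix_and (p : ZeroOneMatrix k k → Prop) :
    Nat.card {P : ZeroOneMatrix k k // P.IsPermutationMatrix ∧ p P} =
      Nat.card {π : Equiv.Perm (Fin k) // p (permMatrix π)} := by
  refine (Nat.card_congr ((Equiv.subtypeEquiv (Equiv.ofBijective _ permMatrix_bijective)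
    (q := fun P => p P.1) fun _ => Iff.rfl).trans
      (Equiv.subtypeSubtypeEquivSubtypeInter _ p))).symm

/-- The antidiagonal sum of the doubled matrix of `π` and the transpose of that of `π⁻¹`. -/
def witnessRel (π : Equiv.Perm (Fin k)) (a b c d x y : ℕ) : Prop :=
  doubled π a b (2 * k - 3) x y ∨ doubled π.symm c d (2 * k - 3) y x

variable {π : Equiv.Perm (Fin k)} {a b c d o x y : ℕ}

theorem doubled.lt (hk : 3 ≤ k) (ha : a + 1 < k) (_ : 0 < b) (hb : b + 1 < k)
    (h : doubled π a b o x y) :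
    x < 2 * k - 3 ∧ o ≤ y ∧ y < o + (2 * k - 2) := by
  rcases h with ⟨j, hj, rfl, rfl⟩ | ⟨j, hj, rfl, rfl⟩
  · have := (π j).2
    refine ⟨?_, ?_, ?_⟩
    · simp only [rowL]; split_ifs <;> omega
    · omega
    · omega
  · have := (π j).2
    refine ⟨?_, ?_, ?_⟩
    · simp only [rowR]; split_ifs <;> omega
    · omega
    · omega

/-- In each block the only one that would lie in this row belongs to the deleted column. -/
theorem doubled.ne (ha : ∀ j : Fin k, j.1 = 0 → (π j).1 = a)
    (hb : ∀ j : Fin k, j.1 + 1 = k → (π j).1 = b) (hk : 0 < k)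
    (ha0 : 0 < a) (ha1 : a + 1 < k) (hb0 : 0 < b) (hb1 : b + 1 < k)
    (h : doubled π a b o x y) : x ≠ a + b - 1 := by
  have ha' := ha ⟨0, hk⟩ rfl
  have hb' := hb ⟨k - 1, by omega⟩ (by simp only; omega)
  rcases h with ⟨j, hj, -, rfl⟩ | ⟨j, hj, -, rfl⟩
  · intro h
    have hr : rowL a b b = a + b - 1 := by simp only [rowL]; split_ifs <;> omega
    have h1 := (rowL_strictMono ha0).injective (h.trans hr.symm)
    have : j = ⟨k - 1, by omega⟩ := π.injective (Fin.ext (by rw [h1, hb']))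
    rw [this] at hj
    simp only at hj
    omega
  · intro h
    have hr : rowR k a b a = a + b - 1 := by simp only [rowR]; split_ifs <;> omega
    have h1 := (rowR_strictMono ha1 hb1 hb0).injective (h.trans hr.symm)
    have : j = ⟨0, hk⟩ := π.injective (Fin.ext (by rw [h1, ha']))
    rw [this] at hj
    simp at hj

/-- A one added anywhere in the empty row of the doubled matrix completes one of its two blocks. -/
theorem exists_copy_of_empty_row (ha : ∀ j : Fin k, j.1 = 0 → (π j).1 = a)
    (hb : ∀ j : Fin k, j.1 + 1 = k → (π j).1 = b) (hk : 3 ≤ k)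
    (ha0 : 0 < a) (ha1 : a + 1 < k) (hb0 : 0 < b) (hb1 : b + 1 < k)
    (hy : y < o + (2 * k - 2)) :
    ∃ f g : Fin k → ℕ, StrictMono f ∧ StrictMono g ∧ (∀ i, f i < 2 * k - 3) ∧
      (∀ j, g j < o + (2 * k - 2)) ∧
      ∀ j, doubled π a b o (f (π j)) (g j) ∨ (f (π j) = a + b - 1 ∧ g j = y) := by
  -- The right block starts in column `o + (k - 1)`. From there on, `y` serves as the last column
  -- missing from the left block; before it, even for `y < o`, as the first column missing from the
  -- right block.
  rcases le_or_gt (o + (k - 1)) y with h | h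
  · refine ⟨fun i => rowL a b i, fun j => if j.1 + 1 = k then y else o + j,
      fun i j hij => rowL_strictMono ha0 hij, fun i j hij => ?_, fun i => ?_, fun j => ?_,
      fun j => ?_⟩
    · have : i.1 < j.1 := hij
      have := j.2
      simp only
      split_ifs <;> omega
    · have := i.2
      simp only [rowL]
      split_ifs <;> omega
    · have := j.2
      simp only
      split_ifs <;> omega
    · by_cases hj : j.1 + 1 = k
      · right
        simp only [hb j hj, hj, if_true, and_true, rowL]
        split_ifs <;> omega
      · left
        exact Or.inl ⟨j, by omega, by simp [hj], rfl⟩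
  · refine ⟨fun i => rowR k a b i, fun j => if j.1 = 0 then y else o + (k - 2) + j,
      fun i j hij => rowR_strictMono ha1 hb1 hb0 hij, fun i j hij => ?_, fun i => ?_, fun j => ?_,
      fun j => ?_⟩
    · have : i.1 < j.1 := hij
      have := j.2
      simp only
      split_ifs <;> omega
    · have := i.2
      simp only [rowR]
      split_ifs <;> omega
    · have := j.2
      simp only
      split_ifs <;> omega
    · by_cases hj : j.1 = 0
      · right
        simp only [ha j hj, hj, if_true, and_true, rowR]
        split_ifs <;> omega
      · left
        exact Or.inr ⟨j, by omega, by simp [hj], rfl⟩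

/-- A generic permutation is not skew-decomposable. -/
theorem IsGeneric.exists_not_iff (hπ : IsGeneric π) {m : ℕ} (hm : 0 < m) (hmk : m < k) :
    ¬ ∀ j, j.1 < m ↔ k - m ≤ (π j).1 := by
  intro H
  by_cases h1 : m = 1
  · have e1 := (H ⟨0, by omega⟩).1 (by simp only; omega)
    have e2 := hπ.interior ⟨0, by omega⟩ (Or.inl rfl)
    omega
  by_cases h2 : m + 1 = k
  · have e1 := (H ⟨k - 1, by omega⟩).not.1 (by simp only; omega)
    have e2 := hπ.interior ⟨k - 1, by omega⟩ (Or.inr (by simp only; omega))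
    omega
  refine hπ.not_isStructured m (by omega) (by omega)
    ⟨0, k - m, k - m, k, by omega, le_rfl, by omega, le_rfl, by omega, fun j _ => ?_⟩
  rw [H j]
  have := (π j).2
  omega

/-- The pieces share no row and no column, and one lies above and to the right of the other. A copy
meeting both would thus split `π` as a skew sum, so a copy lies within one piece. -/
theorem not_witnessRel_of_isGeneric (hπ : IsGeneric π) (hπ' : IsGeneric π.symm)
    (ha : ∀ j : Fin k, j.1 = 0 → (π j).1 = a) (hb : ∀ j : Fin k, j.1 + 1 = k → (π j).1 = b)
    (hc : ∀ j : Fin k, j.1 = 0 → (π.symm j).1 = c)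
    (hd : ∀ j : Fin k, j.1 + 1 = k → (π.symm j).1 = d)
    (hk : 3 ≤ k) {f g : Fin k → ℕ} (hf : StrictMono f) (hg : StrictMono g) :
    ¬ ∀ j, witnessRel π a b c d (f (π j)) (g j) := by
  intro H
  have ha' := ha ⟨0, by omega⟩ rfl ▸ hπ.interior ⟨0, by omega⟩ (Or.inl rfl)
  have hc' := hc ⟨0, by omega⟩ rfl ▸ hπ'.interior ⟨0, by omega⟩ (Or.inl rfl)
  have hlast : (⟨k - 1, by omega⟩ : Fin k).1 + 1 = k := by simp only; omega
  have hb' := hb _ hlast ▸ hπ.interior _ (Or.inr hlast)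
  have hd' := hd _ hlast ▸ hπ'.interior _ (Or.inr hlast)
  obtain ⟨m, hm, hgm⟩ := exists_threshold hg (2 * k - 3)
  obtain ⟨t, ht, hft⟩ := exists_threshold hf (2 * k - 3)
  have hiff : ∀ j, j.1 < m ↔ t ≤ (π j).1 := by
    intro j
    have e1 := hgm j
    have e2 := hft (π j)
    rcases H j with h | h
    · have := h.lt hk ha'.2 hb'.1 hb'.2
      omega
    · have := h.lt hk hc'.2 hd'.1 hd'.2
      omega
  have htm : t = k - m := by
    have hcard : (Finset.univ.filter fun j : Fin k => j.1 < m).card =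
        (Finset.univ.filter fun i : Fin k => t ≤ i.1).card := by
      refine Finset.card_equiv π fun j => ?_
      simp [hiff j]
    have hcompl : (Finset.univ.filter fun i : Fin k => t ≤ i.1).card +
        (Finset.univ.filter fun i : Fin k => i.1 < t).card = k := by
      rw [add_comm]
      simpa using Finset.card_filter_add_card_filter_not (s := (Finset.univ : Finset (Fin k)))
        (fun i => i.1 < t)
    rw [← hcard, Fin.card_filter_val_lt, Fin.card_filter_val_lt] at hcompl
    omega
  subst htm
  rcases Nat.eq_zero_or_pos m with rfl | hm0
  · refine not_doubled_of_isGeneric (o := 2 * k - 3) hπ ha hb (by omega) hf hg fun j => ?_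
    rcases H j with h | h
    · exact h
    · have := h.lt hk hc'.2 hd'.1 hd'.2
      have e2 := hft (π j)
      omega
  rcases hm.eq_or_lt with rfl | hmk
  · refine not_doubled_of_isGeneric (o := 2 * m - 3) hπ' hc hd (by omega) hg hf fun i => ?_
    have := H (π.symm i)
    rw [Equiv.apply_symm_apply] at this
    rcases this with h | h
    · have := h.lt hk ha'.2 hb'.1 hb'.2
      have e1 := hgm (π.symm i)
      omega
    · exact h
  · exact hπ.exists_not_iff hm0 hmk hiff

theorem hasBoundedSat_permMatrix (hk : 3 ≤ k) (hπ : IsGeneric π) (hπ' : IsGeneric π.symm) :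
    (permMatrix π).HasBoundedSat := by
  classical
  have hlast : (⟨k - 1, by omega⟩ : Fin k).1 + 1 = k := by simp only; omega
  have first_eq : ∀ (τ : Equiv.Perm (Fin k)) (j : Fin k), j.1 = 0 →
      (τ j).1 = (τ ⟨0, by omega⟩).1 := fun τ j hj => by
    congr 2; exact Fin.ext hj
  have last_eq : ∀ (τ : Equiv.Perm (Fin k)) (j : Fin k), j.1 + 1 = k →
      (τ j).1 = (τ ⟨k - 1, by omega⟩).1 := fun τ j hj => by
    congr 2; exact Fin.ext (by simp only; omega)
  obtain ⟨a, ha⟩ : ∃ a, ∀ j : Fin k, j.1 = 0 → (π j).1 = a := ⟨_, first_eq π⟩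
  obtain ⟨b, hb⟩ : ∃ b, ∀ j : Fin k, j.1 + 1 = k → (π j).1 = b := ⟨_, last_eq π⟩
  obtain ⟨c, hc⟩ : ∃ c, ∀ j : Fin k, j.1 = 0 → (π.symm j).1 = c := ⟨_, first_eq π.symm⟩
  obtain ⟨d, hd⟩ : ∃ d, ∀ j : Fin k, j.1 + 1 = k → (π.symm j).1 = d := ⟨_, last_eq π.symm⟩
  obtain ⟨ha0, ha1⟩ := ha ⟨0, by omega⟩ rfl ▸ hπ.interior ⟨0, by omega⟩ (Or.inl rfl)
  obtain ⟨hc0, hc1⟩ := hc ⟨0, by omega⟩ rfl ▸ hπ'.interior ⟨0, by omega⟩ (Or.inl rfl)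
  obtain ⟨hb0, hb1⟩ := hb _ hlast ▸ hπ.interior _ (Or.inr hlast)
  obtain ⟨hd0, hd1⟩ := hd _ hlast ▸ hπ'.interior _ (Or.inr hlast)
  -- One piece has `2k - 3` rows and `2k - 2` columns, the other the transposed dimensions, so both
  -- sides have length `4k - 5`.
  refine hasBoundedSat_of_witness (N := 4 * k - 5)
    (A := Matrix.of fun x y => decide (witnessRel π a b c d x.1 y.1)) (by omega)
    (fun i => (isPermutationMatrix_permMatrix π).1 i |>.exists)
    (fun j => (isPermutationMatrix_permMatrix π).2 j |>.exists)
    ?_ ⟨a + b - 1, by omega⟩ ⟨c + d - 1, by omega⟩ ?_ ?_ ?_ ?_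
  · rintro ⟨f, g, hfg⟩
    refine not_witnessRel_of_isGeneric hπ hπ' ha hb hc hd hk (f := fun i => (f i).1)
      (g := fun j => (g j).1) (fun _ _ h => f.strictMono h) (fun _ _ h => g.strictMono h)
      fun j => ?_
    have := hfg (π j) j (permMatrix_eq_true.2 rfl)
    simpa using this
  · intro y
    simp only [Matrix.of_apply, decide_eq_false_iff_not]
    rintro (h | h)
    · exact h.ne ha hb (by omega) ha0 ha1 hb0 hb1 rfl
    · have := (h.lt hk hc1 hd0 hd1).2.1
      omega
  · intro x
    simp only [Matrix.of_apply, decide_eq_false_iff_not]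
    rintro (h | h)
    · have := (h.lt hk ha1 hb0 hb1).2.1
      omega
    · exact h.ne hc hd (by omega) hc0 hc1 hd0 hd1 rfl
  · intro y
    obtain ⟨f, g, hf, hg, hf', hg', hfg⟩ := exists_copy_of_empty_row (o := 2 * k - 3) (y := y.1)
      ha hb hk ha0 ha1 hb0 hb1 (by omega)
    refine ⟨OrderEmbedding.ofStrictMono (fun i => ⟨f i, by have := hf' i; omega⟩)
        fun _ _ h => hf h,
      OrderEmbedding.ofStrictMono (fun j => ⟨g j, by have := hg' j; omega⟩)
        fun _ _ h => hg h, fun i j hij => ?_⟩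
    obtain rfl := permMatrix_eq_true.1 hij
    rcases hfg j with h | ⟨h1, h2⟩
    · refine setOne_of_eq_true ?_ _ _
      simp only [Matrix.of_apply, decide_eq_true_eq]
      exact Or.inl h
    · exact if_pos ⟨Fin.ext h1, Fin.ext h2⟩
  · intro x
    obtain ⟨f, g, hf, hg, hf', hg', hfg⟩ := exists_copy_of_empty_row (o := 2 * k - 3) (y := x.1)
      hc hd hk hc0 hc1 hd0 hd1 (by omega)
    refine ⟨OrderEmbedding.ofStrictMono (fun i => ⟨g i, by have := hg' i; omega⟩)
        fun _ _ h => hg h,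
      OrderEmbedding.ofStrictMono (fun j => ⟨f j, by have := hf' j; omega⟩)
        fun _ _ h => hf h, fun i j hij => ?_⟩
    obtain rfl := permMatrix_eq_true.1 hij
    have := hfg (π j)
    rw [Equiv.symm_apply_apply] at this
    rcases this with h | ⟨h1, h2⟩
    · refine setOne_of_eq_true ?_ _ _
      simp only [Matrix.of_apply, decide_eq_true_eq]
      exact Or.inr h
    · exact if_pos ⟨Fin.ext h2, Fin.ext h1⟩

end PermMatrix
-- Counting non-generic permutations
section Counting

open scoped Classical in
/-- At most `|J|! (n - |J|)!` permutations of `n` points have preimage `J` of a given set. -/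
theorem card_perm_preimage_eq_le {k : ℕ} (J S : Finset (Fin k)) :
    (Finset.univ.filter fun π : Equiv.Perm (Fin k) => ∀ j, j ∈ J ↔ π j ∈ S).card ≤
      J.card.factorial * (k - J.card).factorial := by
  rcases Finset.eq_empty_or_nonempty
    (Finset.univ.filter fun π : Equiv.Perm (Fin k) => ∀ j, j ∈ J ↔ π j ∈ S) with h | ⟨τ, hτ⟩
  · rw [h]
    simp
  have hstab := DomMulAct.stabilizer_card (fun j : Fin k => decide (j ∈ J))
  rw [Fintype.prod_bool] at hstab
  have h1 : Fintype.card {j : Fin k // decide (j ∈ J) = true} = J.card := by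
    simp [Fintype.card_subtype]
  have h2 : Fintype.card {j : Fin k // decide (j ∈ J) = false} = k - J.card := by
    simp [Fintype.card_subtype, Finset.filter_not, Finset.card_sdiff]
  rw [h1, h2, Fintype.card_subtype] at hstab
  rw [← hstab]
  simp only [Finset.mem_filter, Finset.mem_univ, true_and] at hτ
  -- Left translation by the inverse of one such permutation `τ` lands in the stabilizer of `J`.
  refine Finset.card_le_card_of_injOn (fun π => τ⁻¹ * π) (fun π hπ => ?_)
    (fun π _ π' _ h => mul_left_cancel h)
  simp only [Finset.coe_filter, Finset.mem_univ, true_and, Set.mem_ofPred_eq] at hπ ⊢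
  ext j
  have : τ (τ⁻¹ (π j)) = π j := τ.apply_symm_apply _
  refine decide_eq_decide.2 ?_
  rw [hτ, Equiv.Perm.coe_mul, Function.comp_apply, this, ← hπ, hτ]

/-- The rows below `t`, those in a window at `t + d` that are recorded by `T`, and the first
`l - t - w` rows below this window, which has height `e`. -/
def structuredSet (k l : ℕ) (p : ℕ × ℕ × ℕ × ℕ × Finset ℕ) : Finset (Fin k) :=
  Finset.univ.filter fun i =>
    i.1 < p.1 ∨ (p.1 + p.2.1 + p.2.2.1 ≤ i.1 ∧
      i.1 < p.1 + p.2.1 + p.2.2.1 + (l - p.1 - p.2.2.2.1)) ∨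
    ∃ u ∈ p.2.2.2.2, i.1 = p.1 + p.2.1 + u

/-- The parameters of the structured sets of size `l`. -/
def structuredParams (k l : ℕ) : Finset (ℕ × ℕ × ℕ × ℕ × Finset ℕ) :=
  Finset.range (l + 1) ×ˢ Finset.range (k - l + 1) ×ˢ Finset.range 4 ×ˢ Finset.range 4 ×ˢ
    (Finset.range 3).powerset

theorem card_structuredParams (k l : ℕ) :
    (structuredParams k l).card = 128 * ((l + 1) * (k - l + 1)) := by
  simp only [structuredParams, Finset.card_product, Finset.card_range, Finset.card_powerset]
  ring

/-- The set of rows of the first `l` columns has exactly `l` elements, which bounds `t₁` by `l`, the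
gap `t₂ - t₁` by `k - l`, and makes `t₄` computable from the number of its elements in the window.
Hence only two parameters are unbounded. -/
theorem IsStructured.exists_params {k l : ℕ} (hl : l ≤ k) {π : Equiv.Perm (Fin k)}
    (h : IsStructured π l) :
    ∃ p ∈ structuredParams k l, ∀ j : Fin k, j.1 < l ↔ π j ∈ structuredSet k l p := by
  classical
  obtain ⟨t₁, t₂, t₃, t₄, h12, h23, h34, h4, h3, H⟩ := h
  let A : Finset ℕ := (Finset.univ.filter fun j : Fin k => j.1 < l).image fun j => (π j).1
  have hA : ∀ j : Fin k, (π j).1 ∈ A ↔ j.1 < l := by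
    intro j
    simp only [A, Finset.mem_image, Finset.mem_filter, Finset.mem_univ, true_and]
    refine ⟨?_, fun hj => ⟨j, hj, rfl⟩⟩
    rintro ⟨i, hi, hij⟩
    rwa [← π.injective (Fin.ext hij)]
  have hsurj : ∀ x < k, ∃ j, (π j).1 = x := fun x hx => ⟨π.symm ⟨x, hx⟩, by simp⟩
  have hAk : ∀ x ∈ A, x < k := by
    intro x hx
    simp only [A, Finset.mem_image] at hx
    obtain ⟨j, -, rfl⟩ := hx
    exact (π j).2
  have hAcard : A.card = l := by
    rw [Finset.card_image_of_injective _ fun i j hij => π.injective (Fin.ext hij),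
      Fin.card_filter_val_lt]
    omega
  have hmem : ∀ x < k, (x < t₂ ∨ t₃ ≤ x) → (x ∈ A ↔ x < t₁ ∨ (t₃ ≤ x ∧ x < t₄)) := by
    intro x hx hx'
    obtain ⟨j, rfl⟩ := hsurj x hx
    rw [hA, H j hx']
  have hlow : t₁ + (t₄ - t₃) ≤ l := by
    have : (Finset.range t₁ ∪ Finset.Ico t₃ t₄).card = t₁ + (t₄ - t₃) := by
      rw [Finset.card_union_of_disjoint, Finset.card_range, Nat.card_Ico]
      rw [Finset.disjoint_left]
      intro x
      simp only [Finset.mem_range, Finset.mem_Ico]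
      omega
    rw [← this, ← hAcard]
    refine Finset.card_le_card fun x hx => ?_
    simp only [Finset.mem_union, Finset.mem_range, Finset.mem_Ico] at hx
    exact (hmem x (by omega) (by omega)).2 hx
  have hupp : l ≤ t₁ + (t₄ - t₃) + 3 := by
    have : (Finset.range t₁ ∪ Finset.Ico t₃ t₄ ∪ Finset.Ico t₂ t₃).card ≤
        t₁ + (t₄ - t₃) + (t₃ - t₂) := by
      refine (Finset.card_union_le _ _).trans ?_
      have := Finset.card_union_le (Finset.range t₁) (Finset.Ico t₃ t₄)
      simp only [Finset.card_range, Nat.card_Ico] at this ⊢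
      omega
    have h' : A ⊆ Finset.range t₁ ∪ Finset.Ico t₃ t₄ ∪ Finset.Ico t₂ t₃ := by
      intro x hx
      have := hmem x (hAk x hx)
      simp only [Finset.mem_union, Finset.mem_range, Finset.mem_Ico]
      by_cases hx' : x < t₂ ∨ t₃ ≤ x
      · exact Or.inl ((this hx').1 hx)
      · omega
    have := Finset.card_le_card h'
    omega
  have hgap : l + (t₂ - t₁) ≤ k := by
    have : (A ∪ Finset.Ico t₁ t₂).card = l + (t₂ - t₁) := by
      rw [Finset.card_union_of_disjoint, hAcard, Nat.card_Ico]
      rw [Finset.disjoint_left]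
      intro x hx
      have := hmem x (hAk x hx)
      simp only [Finset.mem_Ico]
      intro hx'
      have := (this (by omega)).1 hx
      omega
    rw [← this]
    refine (Finset.card_le_card (t := Finset.range k) fun x hx => ?_).trans_eq
      (Finset.card_range k)
    simp only [Finset.mem_union, Finset.mem_Ico] at hx
    rw [Finset.mem_range]
    rcases hx with hx | hx
    · exact hAk x hx
    · omega
  -- The fourth entry is the number of elements of `A` in the window.
  refine ⟨(t₁, t₂ - t₁, t₃ - t₂, l - t₁ - (t₄ - t₃),
    (Finset.range 3).filter fun u => t₂ + u < t₃ ∧ t₂ + u ∈ A), ?_, fun j => ?_⟩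
  · simp only [structuredParams, Finset.mem_product, Finset.mem_range, Finset.mem_powerset,
      Finset.filter_subset, and_true]
    omega
  · simp only [structuredSet, Finset.mem_filter, Finset.mem_univ, true_and, Finset.mem_range]
    have e1 : t₁ + (t₂ - t₁) = t₂ := by omega
    have e2 : t₂ + (t₃ - t₂) = t₃ := by omega
    have e3 : t₃ + (l - t₁ - (l - t₁ - (t₄ - t₃))) = t₄ := by omega
    rw [e1, e2, e3, ← hA]
    by_cases hx : (π j).1 < t₂ ∨ t₃ ≤ (π j).1
    · rw [hmem _ (π j).2 hx]
      constructor
      · rintro (h | h)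
        · exact Or.inl h
        · exact Or.inr (Or.inl h)
      · rintro (h | h | ⟨u, hu, h⟩)
        · exact Or.inl h
        · exact Or.inr h
        · omega
    · constructor
      · intro h
        refine Or.inr (Or.inr ⟨(π j).1 - t₂, ⟨by omega, by omega, ?_⟩, by omega⟩)
        rwa [show t₂ + ((π j).1 - t₂) = (π j).1 by omega]
      · rintro (h | h | ⟨u, hu, h⟩)
        · omega
        · omega
        · rw [h]
          exact hu.2.2

open scoped Classical in
theorem card_isStructured_le {k l : ℕ} (hl : l ≤ k) :
    (Finset.univ.filter fun π : Equiv.Perm (Fin k) => IsStructured π l).card ≤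
      128 * ((l + 1).factorial * (k - l + 1).factorial) := by
  have hsub : (Finset.univ.filter fun π : Equiv.Perm (Fin k) => IsStructured π l) ⊆
      (structuredParams k l).biUnion fun p => Finset.univ.filter fun π : Equiv.Perm (Fin k) =>
        ∀ j, j ∈ (Finset.univ.filter fun j : Fin k => j.1 < l) ↔ π j ∈ structuredSet k l p := by
    intro π hπ
    obtain ⟨p, hp, h⟩ := IsStructured.exists_params hl (Finset.mem_filter.1 hπ).2
    simp only [Finset.mem_biUnion, Finset.mem_filter, Finset.mem_univ, true_and]
    exact ⟨p, hp, h⟩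
  refine (Finset.card_le_card hsub).trans ((Finset.card_biUnion_le_card_mul _ _
    (l.factorial * (k - l).factorial) fun p _ => ?_).trans_eq ?_)
  · refine (card_perm_preimage_eq_le _ _).trans_eq ?_
    rw [Fin.card_filter_val_lt, min_eq_right hl]
  · rw [card_structuredParams, Nat.factorial_succ, Nat.factorial_succ]
    ring

open scoped Classical in
theorem card_perm_apply_eq_le {k : ℕ} (j i : Fin k) :
    (Finset.univ.filter fun π : Equiv.Perm (Fin k) => π j = i).card ≤ (k - 1).factorial := by
  refine le_trans (Finset.card_le_card ?_) ((card_perm_preimage_eq_le {j} {i}).trans_eq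
    (by simp))
  intro π
  simp only [Finset.mem_filter, Finset.mem_univ, true_and, Finset.mem_singleton]
  rintro rfl x
  simp

/-- For a fixed sum, a product of factorials is largest when one factor is as small as allowed, here
`4! = 24`. -/
theorem factorial_mul_factorial_le {a b : ℕ} (ha : 4 ≤ a) (hb : 4 ≤ b) :
    a.factorial * b.factorial ≤ 24 * (a + b - 4).factorial := by
  induction b, hb using Nat.le_induction with
  | base => rw [mul_comm, show a + 4 - 4 = a by omega]; rfl
  | succ b hb ih =>
    rw [show a + (b + 1) - 4 = (a + b - 4) + 1 by omega, Nat.factorial_succ, Nat.factorial_succ]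
    calc a.factorial * ((b + 1) * b.factorial) = (b + 1) * (a.factorial * b.factorial) := by ring
      _ ≤ (a + b - 4 + 1) * (24 * (a + b - 4).factorial) := Nat.mul_le_mul (by omega) ih
      _ = _ := by ring

/-- Only the end terms `l = 2` and `l = k - 2` have order `(k - 1)!`, with factor `3! = 6`. Each
other term is at most `24 (k - 2)!`, and there are fewer than `k - 1` of them. -/
theorem sum_factorial_mul_factorial_le {k : ℕ} (hk : 2 ≤ k) :
    ∑ l ∈ Finset.Icc 2 (k - 2), (l + 1).factorial * (k - l + 1).factorial ≤
      60 * (k - 1).factorial := by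
  have hterm : ∀ l ∈ Finset.Icc 2 (k - 2), (l + 1).factorial * (k - l + 1).factorial ≤
      24 * (k - 2).factorial + ((if l = 2 then 6 * (k - 1).factorial else 0) +
        if l = k - 2 then 6 * (k - 1).factorial else 0) := by
    intro l hl
    rw [Finset.mem_Icc] at hl
    by_cases h1 : l = 2
    · subst h1
      rw [if_pos rfl, show k - 2 + 1 = k - 1 by omega, show Nat.factorial (2 + 1) = 6 from rfl]
      omega
    by_cases h2 : l = k - 2
    · rw [if_pos h2, show l + 1 = k - 1 by omega, show k - l + 1 = 3 by omega,
        show Nat.factorial 3 = 6 from rfl]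
      omega
    · rw [if_neg h1, if_neg h2]
      refine (factorial_mul_factorial_le (by omega) (by omega)).trans_eq ?_
      rw [show l + 1 + (k - l + 1) - 4 = k - 2 by omega]
      rfl
  refine (Finset.sum_le_sum hterm).trans ?_
  rw [Finset.sum_add_distrib, Finset.sum_add_distrib, Finset.sum_const, Finset.sum_ite_eq',
    Finset.sum_ite_eq', Nat.card_Icc, smul_eq_mul]
  have hfac : (k - 1).factorial = (k - 1) * (k - 2).factorial := by
    rw [show k - 1 = (k - 2) + 1 by omega, Nat.factorial_succ]
  have hcount : (k - 2 + 1 - 2) * (24 * (k - 2).factorial) ≤ 24 * (k - 1).factorial := by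
    rw [hfac]
    calc (k - 2 + 1 - 2) * (24 * (k - 2).factorial) ≤ (k - 1) * (24 * (k - 2).factorial) :=
          Nat.mul_le_mul_right _ (by omega)
      _ = _ := by ring
  split_ifs <;> omega

open scoped Classical in
-- The constant is `4 + 128 * 60`: four corners, and the structured permutations summed over `l`.
theorem card_not_isGeneric_le {k : ℕ} (hk : 2 ≤ k) :
    (Finset.univ.filter fun π : Equiv.Perm (Fin k) => ¬ IsGeneric π).card ≤
      7684 * (k - 1).factorial := by
  let E : Finset (Fin k) := {⟨0, by omega⟩, ⟨k - 1, by omega⟩}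
  have hE : ∀ i : Fin k, (i.1 = 0 ∨ i.1 + 1 = k) → i ∈ E := by
    intro i hi
    simp only [E, Finset.mem_insert, Finset.mem_singleton, Fin.ext_iff]
    omega
  have hsub : (Finset.univ.filter fun π : Equiv.Perm (Fin k) => ¬ IsGeneric π) ⊆
      ((E ×ˢ E).biUnion fun p => Finset.univ.filter fun π : Equiv.Perm (Fin k) => π p.1 = p.2) ∪
      (Finset.Icc 2 (k - 2)).biUnion fun l =>
        Finset.univ.filter fun π : Equiv.Perm (Fin k) => IsStructured π l := by
    intro π hπ
    simp only [Finset.mem_filter, Finset.mem_univ, true_and] at hπ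
    simp only [Finset.mem_union, Finset.mem_biUnion, Finset.mem_filter, Finset.mem_univ, true_and,
      Finset.mem_Icc]
    by_contra! hcon
    refine hπ ⟨fun j hj => ?_, fun l hl hlk => hcon.2 l ⟨hl, by omega⟩⟩
    by_contra hcorner
    have := (π j).2
    exact hcon.1 (j, π j) (Finset.mem_product.2 ⟨hE j hj, hE (π j) (by omega)⟩) rfl
  have hcorners : ((E ×ˢ E).biUnion fun p =>
      Finset.univ.filter fun π : Equiv.Perm (Fin k) => π p.1 = p.2).card ≤
        4 * (k - 1).factorial := by
    refine (Finset.card_biUnion_le_card_mul _ _ _ fun p _ => card_perm_apply_eq_le p.1 p.2).trans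
      (Nat.mul_le_mul_right _ ?_)
    rw [Finset.card_product]
    exact Nat.mul_le_mul Finset.card_le_two Finset.card_le_two
  have hstruct : ((Finset.Icc 2 (k - 2)).biUnion fun l =>
      Finset.univ.filter fun π : Equiv.Perm (Fin k) => IsStructured π l).card ≤
        128 * (60 * (k - 1).factorial) := by
    refine Finset.card_biUnion_le.trans ((Finset.sum_le_sum fun l hl =>
      card_isStructured_le (by rw [Finset.mem_Icc] at hl; omega)).trans ?_)
    rw [← Finset.mul_sum]
    exact Nat.mul_le_mul_left _ (sum_factorial_mul_factorial_le hk)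
  have h1 := Finset.card_le_card hsub
  have h2 := Finset.card_union_le ((E ×ˢ E).biUnion fun p =>
      Finset.univ.filter fun π : Equiv.Perm (Fin k) => π p.1 = p.2)
    ((Finset.Icc 2 (k - 2)).biUnion fun l =>
      Finset.univ.filter fun π : Equiv.Perm (Fin k) => IsStructured π l)
  omega

/-- Both `π` and its inverse have to be generic; inversion is a bijection, so the bound `7684` is
doubled. -/
theorem factorial_le_card_hasBoundedSat {k : ℕ} (hk : 3 ≤ k) :
    k.factorial ≤ Nat.card {π : Equiv.Perm (Fin k) // (permMatrix π).HasBoundedSat} +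
      15368 * (k - 1).factorial := by
  classical
  rw [Nat.card_eq_fintype_card, Fintype.card_subtype]
  have hsub : (Finset.univ : Finset (Equiv.Perm (Fin k))) ⊆
      (Finset.univ.filter fun π : Equiv.Perm (Fin k) => (permMatrix π).HasBoundedSat) ∪
      ((Finset.univ.filter fun π : Equiv.Perm (Fin k) => ¬ IsGeneric π) ∪
        Finset.univ.filter fun π : Equiv.Perm (Fin k) => ¬ IsGeneric π.symm) := by
    intro π _
    simp only [Finset.mem_union, Finset.mem_filter, Finset.mem_univ, true_and]
    by_contra! hcon
    exact hcon.1 (hasBoundedSat_permMatrix hk hcon.2.1 hcon.2.2)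
  have hsymm : (Finset.univ.filter fun π : Equiv.Perm (Fin k) => ¬ IsGeneric π.symm).card =
      (Finset.univ.filter fun π : Equiv.Perm (Fin k) => ¬ IsGeneric π).card :=
    Finset.card_equiv (Equiv.inv (Equiv.Perm (Fin k))) fun π => by
      simp only [Finset.mem_filter, Finset.mem_univ, true_and]
      rfl
  have h1 := Finset.card_le_card hsub
  rw [Finset.card_univ, Fintype.card_perm, Fintype.card_fin] at h1
  have h2 := h1.trans ((Finset.card_union_le _ _).trans
    (Nat.add_le_add_left (Finset.card_union_le _ _) _))
  have h3 := card_not_isGeneric_le (show 2 ≤ k by omega)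
  omega

end Counting
end ZeroOneMatrix

/-! ### Passage to the limit -/

open ZeroOneMatrix in
theorem theorem1 :
    Tendsto
      (fun k : ℕ =>
        (Nat.card {P : ZeroOneMatrix k k // P.IsPermutationMatrix ∧ P.HasBoundedSat} : ℝ) /
          (Nat.card {P : ZeroOneMatrix k k // P.IsPermutationMatrix} : ℝ))
      atTop (𝓝 1) := by
  have hlim : Tendsto (fun k : ℕ => 1 - (15368 : ℝ) / (k : ℝ)) atTop (𝓝 1) := by
    simpa using (tendsto_const_div_atTop_nhds_zero_nat (15368 : ℝ)).const_sub 1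
  refine tendsto_of_tendsto_of_tendsto_of_le_of_le' hlim tendsto_const_nhds ?_ ?_
  · filter_upwards [eventually_ge_atTop 3] with k hk
    rw [card_isPermutationMatrix_and, card_isPermutationMatrix]
    have hfac : (k.factorial : ℝ) = k * (k - 1).factorial := by
      exact_mod_cast (Nat.mul_factorial_pred (by omega)).symm
    have hpos : (0 : ℝ) < (k - 1).factorial := by exact_mod_cast Nat.factorial_pos _
    have hk0 : (0 : ℝ) < k := by exact_mod_cast (by omega : 0 < k)
    have h : (k.factorial : ℝ) ≤
        Nat.card {π : Equiv.Perm (Fin k) // (permMatrix π).HasBoundedSat} +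
          15368 * (k - 1).factorial := by
      exact_mod_cast factorial_le_card_hasBoundedSat hk
    rw [le_div_iff₀ (by rw [hfac]; positivity)]
    have : (1 - 15368 / (k : ℝ)) * k.factorial = k.factorial - 15368 * (k - 1).factorial := by
      rw [hfac]
      field_simp
    rw [this]
    linarith
  · filter_upwards with k
    refine div_le_one_of_le₀ ?_ (Nat.cast_nonneg _)
    exact_mod_cast Nat.card_le_card_of_injective
      (fun P : {P : ZeroOneMatrix k k // P.IsPermutationMatrix ∧ P.HasBoundedSat} =>
        (⟨P.1, P.2.1⟩ : {P : ZeroOneMatrix k k // P.IsPermutationMatrix}))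
      fun P Q h => Subtype.ext (Subtype.mk.inj h)
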